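/- Let $\mathcal H$ be a complex Hilbert space, let $A,B$ be (possibly unbounded) skew-adjoint operators on $\mathcal H$, and let $(\phi_k)_{k\in\mathbf N}$ be an orthonormal basis of $\mathcal H$ consisting of eigenvectors of $A$, with $\phi_k\in D(B)$ for every $k$. Let $\delta>0$ and put $V=\mathrm{span}\{\phi_k\mid k\in\mathbf N\}$ (finite linear combinations). Let $u:[0,T_u]\to(0,\delta)$ be piecewise constant, i.e. there are $0=s_0<s_1<\dots<s_n=T_u$ such that $u$ equals a constant $u_j$ on $[s_{j-1},s_j)$ for $j=1,\dots,n$. For each value $v$ of $u$ let $A+vB$ denote a skew-adjoint operator extending $A|_V+vB|_V$ (any fixed choice, if there are several), and let $e^{t(A+vB)}$, $t\in\mathbf R$, be the unitary group that it generates. The solution of $$\frac{d\psi}{dt}(t)=A\psi(t)+u(t)B\psi(t),\qquad \psi(0)=\psi_0,$$ is the curve $\psi:[0,T_u]\to\mathcal H$ with $\psi(0)=\psi_0$ and $\psi(t)=e^{(t-s_{j-1})(A+u_jB)}\psi(s_{j-1})$ for $t\in[s_{j-1},s_j]$, $j=1,\dots,n$. Let $\psi_0,\psi_1\in\mathcal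 H$ be unit vectors and let $\varepsilon>0$. If the solution with $\psi(0)=\psi_0$ satisfies $\|\psi(T_u)-\psi_1\|<\varepsilon$, then $$T_u\ \ge\ \frac1\delta\,\sup_{k\in\mathbf N}\frac{\big||\langle\phi_k,\psi_0\rangle|-|\langle\phi_k,\psi_1\rangle|\big|-\varepsilon}{\|B\phi_k\|},$$ where the supremum is taken in $[-\infty,+\infty]$ and, when $\|B\phi_k\|=0$, the quotient $a/0$ is read as $+\infty$ if $a>0$ and as $-\infty$ if $a\le 0$. No controllability assumption is made. -/

import Mathlib

open scoped InnerProductSpace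

noncomputable section

namespace BilinearControl

variable {H : Type*} [NormedAddCommGroup H] [InnerProductSpace ℂ H] [CompleteSpace H]

/-- A (possibly unbounded) operator `C` is skew-adjoint: it is densely defined and its Hilbert
space adjoint is `-C` (equality of domains included). -/
def IsSkewAdjoint (C : H →ₗ.[ℂ] H) : Prop :=
  Dense (C.domain : Set H) ∧ C.adjoint = -C

/-- `(A, B)` with the orthonormal basis `φ` satisfies (H1) `A` and `B` are skew-adjoint,
(H2) every `φ n` is an eigenvector of `A`, (H3) every `φ n` lies in the domain of `B`. -/
structure IsSkewAdjointDiscreteSpectrum (A B : H →ₗ.[ℂ] H) (φ : HilbertBasis ℕ ℂ H) : Prop where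
  skewAdjoint_A : IsSkewAdjoint A
  skewAdjoint_B : IsSkewAdjoint B
  eigenvector : ∀ n, ∃ hn : φ n ∈ A.domain, ∃ μ : ℂ, A ⟨φ n, hn⟩ = μ • φ n
  mem_domain_B : ∀ n, φ n ∈ B.domain

/-- The algebraic span `V` of the basis vectors (finite linear combinations, no closure). -/
def basisSpan (φ : HilbertBasis ℕ ℂ H) : Submodule ℂ H :=
  Submodule.span ℂ (Set.range φ)

/-- `C` is a skew-adjoint operator extending `A|_V + v B|_V`, that is, a meaning of `A + v B`. -/
def IsSkewAdjointSum (A B : H →ₗ.[ℂ] H) (φ : HilbertBasis ℕ ℂ H) (v : ℝ) (C : H →ₗ.[ℂ] H) :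
    Prop :=
  IsSkewAdjoint C ∧ (A + (v : ℂ) • B).domRestrict (basisSpan φ) ≤ C

/-- `G` is a strongly continuous one-parameter group of unitary operators with infinitesimal
generator `C`: the domain of `C` is the set of those `x` for which `t ↦ G t x` is differentiable
at `0`, and `C x` is then the derivative. -/
structure IsUnitaryGroupOf (C : H →ₗ.[ℂ] H) (G : ℝ → H ≃ₗᵢ[ℂ] H) : Prop where
  zero_apply : ∀ x, G 0 x = x
  add_apply : ∀ s t x, G (s + t) x = G s (G t x)
  continuous_apply : ∀ x, Continuous fun t => G t x
  generator : ∀ x y, (x, y) ∈ C.graph ↔ HasDerivAt (fun t => G t x) y 0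

open Classical in
/-- The unitary group `t ↦ e^{tC}` generated by a skew-adjoint operator `C`. By Stone's theorem
it exists and is unique; for other operators `C` the value is irrelevant. -/
def expGroup (C : H →ₗ.[ℂ] H) : ℝ → H ≃ₗᵢ[ℂ] H :=
  if h : ∃ G, IsUnitaryGroupOf C G then h.choose else fun _ => LinearIsometryEquiv.refl ℂ H

/-- `0 = s 0 < s 1 < ⋯ < s n = T` is a partition of `[0, T]` such that `u` is constant on each
`[s j, s (j + 1))`. -/
structure IsAdaptedPartition (u : ℝ → ℝ) (T : ℝ) {n : ℕ} (s : Fin (n + 1) → ℝ) : Prop where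
  strictMono : StrictMono s
  first : s 0 = 0
  last : s (Fin.last n) = T
  const : ∀ j : Fin n, ∀ t ∈ Set.Ico (s j.castSucc) (s j.succ), u t = u (s j.castSucc)

/-- `u` is piecewise constant on `[0, T]`. -/
def IsPiecewiseConstant (u : ℝ → ℝ) (T : ℝ) : Prop :=
  ∃ (n : ℕ) (s : Fin (n + 1) → ℝ), IsAdaptedPartition u T s

/-- `ψ` is the solution on `[0, T]` of `ψ' = (A + u B) ψ`, `ψ 0 = ψ₀`, for a piecewise constant
control `u`, where `E v` is the skew-adjoint operator that stands for `A + v B`: on each interval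
of constancy, `ψ` moves by the unitary group generated by `E (u_j)`. -/
def IsSolution (E : ℝ → (H →ₗ.[ℂ] H)) (u : ℝ → ℝ) (T : ℝ) (ψ₀ : H) (ψ : ℝ → H) : Prop :=
  ψ 0 = ψ₀ ∧ ∃ (n : ℕ) (s : Fin (n + 1) → ℝ), IsAdaptedPartition u T s ∧
    ∀ j : Fin n, ∀ t ∈ Set.Icc (s j.castSucc) (s j.succ),
      ψ t = expGroup (E (u (s j.castSucc))) (t - s j.castSucc) (ψ (s j.castSucc))

/-- The extended real quotient `a / b` for `b ≥ 0`, with `a / 0 = +∞` if `a > 0` and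
`a / 0 = -∞` if `a ≤ 0`. -/
def extendedQuotient (a b : ℝ) : EReal :=
  if b = 0 then (if 0 < a then ⊤ else ⊥) else ((a / b : ℝ) : EReal)

end BilinearControl

end

/-!
Fix an eigenvector `φ k` of `A` with eigenvalue `μ`. Since `A` is skew-adjoint, `μ` is purely
imaginary (`IsSkewAdjoint.re_eigenvalue_eq_zero`). On an interval where the control equals `v`, the
state moves by the unitary group `G` of a skew-adjoint operator `C` with
`C (φ k) = μ • φ k + v • B (φ k)`. The curve `t ↦ exp (-t μ) • G t (φ k)` has derivative
`exp (-t μ) • G t (v • B (φ k))`, of constant norm `v * ‖B (φ k)‖`: the drift `A` only contributes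
a phase. As `‖⟪φ k, G t x⟫‖ = ‖⟪G (-t) (φ k), x⟫‖` is insensitive to phases, the modulus of the
`k`-th coordinate of the state varies at speed at most `v * ‖B (φ k)‖` (`abs_norm_inner_sub_le`).

Adding up the intervals, the modulus varies by at most `δ * T * ‖B (φ k)‖` on `[0, T]`
(`IsSolution.abs_norm_inner_sub_le`), and ending within `ε` of `ψ₁` costs another `ε`.

The speed bound applies the generator only to the fixed vector `φ k`, so no regularity of the state
is needed.
-/

open scoped InnerProductSpace

namespace BilinearControl

variable {H : Type*} [NormedAddCommGroup H] [InnerProductSpace ℂ H] [CompleteSpace H]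

theorem IsSkewAdjoint.re_eigenvalue_eq_zero {A : H →ₗ.[ℂ] H} (hA : IsSkewAdjoint A)
    {x : A.domain} (hx : (x : H) ≠ 0) {μ : ℂ} (h : A x = μ • (x : H)) : μ.re = 0 := by
  have hadj : (-A).IsFormalAdjoint A := by
    have := LinearPMap.adjoint_isFormalAdjoint (T := A) hA.1
    rwa [hA.2] at this
  have key := hadj x x
  rw [LinearPMap.neg_apply, h, inner_neg_left, inner_smul_left, inner_smul_right] at key
  have hne : ⟪(x : H), (x : H)⟫_ℂ ≠ 0 := inner_self_ne_zero.mpr hx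
  have hconj : -(starRingEnd ℂ μ) = μ :=
    mul_right_cancel₀ hne (by rw [neg_mul]; exact key)
  have hre := congrArg Complex.re hconj
  simp only [Complex.neg_re, Complex.conj_re] at hre
  linarith

/-- Any skew-adjoint meaning of `A + v B` takes the expected value on a basis vector. -/
theorem IsSkewAdjointSum.graph_mem {A B C : H →ₗ.[ℂ] H} {φ : HilbertBasis ℕ ℂ H} {v : ℝ}
    (hC : IsSkewAdjointSum A B φ v C) {k : ℕ} (hkA : φ k ∈ A.domain) (hkB : φ k ∈ B.domain) :
    (φ k, A ⟨φ k, hkA⟩ + (v : ℂ) • B ⟨φ k, hkB⟩) ∈ C.graph := by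
  refine LinearPMap.le_graph_of_le hC.2 ?_
  have hV : φ k ∈ basisSpan φ := Submodule.subset_span ⟨k, rfl⟩
  rw [LinearPMap.mem_graph_iff]
  exact ⟨⟨φ k, ⟨hV, hkA, hkB⟩⟩, rfl, rfl⟩

theorem IsUnitaryGroupOf.hasDerivAt {C : H →ₗ.[ℂ] H} {G : ℝ → H ≃ₗᵢ[ℂ] H}
    (hG : IsUnitaryGroupOf C G) {x y : H} (hxy : (x, y) ∈ C.graph) (t : ℝ) :
    HasDerivAt (fun r => G r x) (G t y) t := by
  have h0 : HasDerivAt (fun r => G r x) y (t - t) := by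
    rw [sub_self]; exact (hG.generator x y).1 hxy
  have h1 : HasDerivAt (fun r => G (r - t) x) y t := h0.comp_sub_const t t
  have h2 := ((G t).toContinuousLinearEquiv.toContinuousLinearMap.restrictScalars
    ℝ).hasFDerivAt.comp_hasDerivAt t h1
  refine h2.congr_of_eventuallyEq (Filter.Eventually.of_forall fun r => ?_)
  change G r x = G t (G (r - t) x)
  rw [← hG.add_apply, add_sub_cancel]

/-- If the generator acts on `x` as a purely imaginary scalar up to an error `b`, then up to a
phase the group moves `x` at speed `‖b‖`. -/
theorem IsUnitaryGroupOf.norm_exp_smul_sub_le {C : H →ₗ.[ℂ] H} {G : ℝ → H ≃ₗᵢ[ℂ] H}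
    (hG : IsUnitaryGroupOf C G) {x b : H} {μ : ℂ} (hμ : μ.re = 0)
    (hx : (x, μ • x + b) ∈ C.graph) (t : ℝ) :
    ‖Complex.exp (-(t * μ)) • G t x - x‖ ≤ ‖b‖ * |t| := by
  have hderiv (r : ℝ) : HasDerivAt (fun r : ℝ => Complex.exp (-(r * μ)) • G r x)
      (Complex.exp (-(r * μ)) • G r b) r := by
    have h1 : HasDerivAt (fun r : ℝ => Complex.exp (-(r * μ)))
        (Complex.exp (-(r * μ)) * -(1 * μ)) r :=
      (((hasDerivAt_id r).ofReal_comp.mul_const μ).neg).cexp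
    refine (h1.smul (hG.hasDerivAt hx r)).congr_deriv ?_
    rw [map_add, map_smul]
    module
  have hnorm (r : ℝ) : ‖Complex.exp (-(r * μ)) • G r b‖ ≤ ‖b‖ := by
    rw [norm_smul, Complex.norm_exp, LinearIsometryEquiv.norm_map]
    simp [hμ]
  have := convex_univ.norm_image_sub_le_of_norm_hasDerivWithin_le
    (fun r _ => (hderiv r).hasDerivWithinAt) (fun r _ => hnorm r)
    (Set.mem_univ (0 : ℝ)) (Set.mem_univ t)
  simpa [hG.zero_apply] using this

theorem IsUnitaryGroupOf.abs_norm_inner_sub_le {C : H →ₗ.[ℂ] H} {G : ℝ → H ≃ₗᵢ[ℂ] H}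
    (hG : IsUnitaryGroupOf C G) {x b : H} {μ : ℂ} (hμ : μ.re = 0)
    (hx : (x, μ • x + b) ∈ C.graph) (t : ℝ) (y : H) :
    |‖⟪x, G t y⟫_ℂ‖ - ‖⟪x, y⟫_ℂ‖| ≤ ‖b‖ * |t| * ‖y‖ := by
  have hinv : G (-t) (G t y) = y := by
    rw [← hG.add_apply, neg_add_cancel, hG.zero_apply]
  have hphase : ‖⟪x, G t y⟫_ℂ‖ =
      ‖⟪Complex.exp (-((-t : ℝ) * μ)) • G (-t) x, y⟫_ℂ‖ := by
    rw [← LinearIsometryEquiv.inner_map_map (G (-t)) x, hinv, inner_smul_left, norm_mul,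
      RCLike.norm_conj, Complex.norm_exp]
    simp [hμ]
  rw [hphase]
  refine (abs_norm_sub_norm_le _ _).trans ?_
  rw [← inner_sub_left]
  refine (norm_inner_le_norm _ _).trans ?_
  gcongr
  simpa using hG.norm_exp_smul_sub_le hμ hx (-t)

/-- Under the unitary group of `A + v B`, the modulus of the `k`-th coordinate varies at speed at
most `|v| * ‖B (φ k)‖`. -/
theorem IsSkewAdjointSum.abs_norm_inner_sub_le {A B C : H →ₗ.[ℂ] H} {φ : HilbertBasis ℕ ℂ H}
    (hAB : IsSkewAdjointDiscreteSpectrum A B φ) {v : ℝ} (hC : IsSkewAdjointSum A B φ v C)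
    (k : ℕ) (t : ℝ) (y : H) :
    |‖⟪φ k, expGroup C t y⟫_ℂ‖ - ‖⟪φ k, y⟫_ℂ‖| ≤
      |v| * ‖B ⟨φ k, hAB.mem_domain_B k⟩‖ * |t| * ‖y‖ := by
  unfold expGroup
  split_ifs with h
  · obtain ⟨hkA, μ, hμ⟩ := hAB.eigenvector k
    have hne : φ k ≠ 0 := φ.orthonormal.ne_zero k
    have hre : μ.re = 0 := hAB.skewAdjoint_A.re_eigenvalue_eq_zero (x := ⟨φ k, hkA⟩) hne hμ
    have hgraph := hC.graph_mem hkA (hAB.mem_domain_B k)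
    rw [hμ] at hgraph
    simpa [norm_smul] using h.choose_spec.abs_norm_inner_sub_le hre hgraph t y
  · -- Stone's theorem excludes this case; the bound does not depend on that, as `expGroup` is
    -- then the identity.
    simp only [LinearIsometryEquiv.coe_refl, id_eq, sub_self, abs_zero]
    positivity

theorem IsSolution.abs_norm_inner_sub_le {A B : H →ₗ.[ℂ] H} {φ : HilbertBasis ℕ ℂ H}
    (hAB : IsSkewAdjointDiscreteSpectrum A B φ) {δ T : ℝ} {u : ℝ → ℝ}
    (huδ : ∀ t ∈ Set.Icc 0 T, u t ∈ Set.Ioo 0 δ) {E : ℝ → (H →ₗ.[ℂ] H)}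
    (hE : ∀ t ∈ Set.Icc 0 T, IsSkewAdjointSum A B φ (u t) (E (u t))) {ψ₀ : H} {ψ : ℝ → H}
    (hψ : IsSolution E u T ψ₀ ψ) (k : ℕ) :
    |‖⟪φ k, ψ T⟫_ℂ‖ - ‖⟪φ k, ψ₀⟫_ℂ‖| ≤
      δ * T * ‖B ⟨φ k, hAB.mem_domain_B k⟩‖ * ‖ψ₀‖ := by
  obtain ⟨h0, n, s, hs, hstep⟩ := hψ
  set b := ‖B ⟨φ k, hAB.mem_domain_B k⟩‖
  have hmain : ∀ i : Fin (n + 1), ‖ψ (s i)‖ = ‖ψ₀‖ ∧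
      |‖⟪φ k, ψ (s i)⟫_ℂ‖ - ‖⟪φ k, ψ₀⟫_ℂ‖| ≤ δ * s i * b * ‖ψ₀‖ := by
    intro i
    induction i using Fin.induction with
    | zero => simp [hs.first, h0]
    | succ j ih =>
      have hlt : s j.castSucc < s j.succ := hs.strictMono Fin.castSucc_lt_succ
      have hmem : s j.castSucc ∈ Set.Icc 0 T :=
        ⟨hs.first ▸ hs.strictMono.monotone (Fin.zero_le _),
          hs.last ▸ hs.strictMono.monotone (Fin.le_last _)⟩
      have hψj := hstep j (s j.succ) (Set.right_mem_Icc.2 hlt.le)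
      have hspeed := (hE _ hmem).abs_norm_inner_sub_le hAB k (s j.succ - s j.castSucc)
        (ψ (s j.castSucc))
      rw [← hψj, ih.1, abs_of_pos (huδ _ hmem).1, abs_of_pos (sub_pos.2 hlt)] at hspeed
      refine ⟨by rw [hψj, LinearIsometryEquiv.norm_map, ih.1], ?_⟩
      have hbound : u (s j.castSucc) * b * (s j.succ - s j.castSucc) * ‖ψ₀‖ ≤
          δ * b * (s j.succ - s j.castSucc) * ‖ψ₀‖ := by
        have := (huδ _ hmem).2.le
        have := (sub_pos.2 hlt).le
        gcongr
      calc _ ≤ _ := abs_sub_le _ ‖⟪φ k, ψ (s j.castSucc)⟫_ℂ‖ _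
        _ ≤ δ * b * (s j.succ - s j.castSucc) * ‖ψ₀‖ + δ * s j.castSucc * b * ‖ψ₀‖ :=
          add_le_add (hspeed.trans hbound) ih.2
        _ = δ * s j.succ * b * ‖ψ₀‖ := by ring
  simpa only [hs.last] using (hmain (Fin.last n)).2

/-- Strictness of `ha` is what rules out the value `⊤` when `b = 0`. -/
theorem extendedQuotient_le_of_lt_mul {a b c : ℝ} (hb : 0 ≤ b) (ha : a < c * b) :
    extendedQuotient a b ≤ (c : EReal) := by
  unfold extendedQuotient
  split_ifs with h0 h1
  · simp only [h0, mul_zero] at ha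
    exact absurd h1 ha.not_gt
  · exact bot_le
  · exact EReal.coe_le_coe_iff.2 ((div_le_iff₀ (hb.lt_of_ne' h0)).2 ha.le)

end BilinearControl

open BilinearControl in
theorem mainTheorem5 {H : Type*} [NormedAddCommGroup H] [InnerProductSpace ℂ H] [CompleteSpace H]
    (A B : H →ₗ.[ℂ] H) (φ : HilbertBasis ℕ ℂ H)
    (hAB : IsSkewAdjointDiscreteSpectrum A B φ)
    (δ : ℝ) (hδ : 0 < δ)
    (ψ₀ ψ₁ : H) (hψ₀ : ‖ψ₀‖ = 1) (hψ₁ : ‖ψ₁‖ = 1)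
    (ε : ℝ) (hε : 0 < ε)
    (T : ℝ) (u : ℝ → ℝ)
    (hu : IsPiecewiseConstant u T)
    (huδ : ∀ t ∈ Set.Icc 0 T, u t ∈ Set.Ioo 0 δ)
    (E : ℝ → (H →ₗ.[ℂ] H))
    (hE : ∀ t ∈ Set.Icc 0 T, IsSkewAdjointSum A B φ (u t) (E (u t)))
    (ψ : ℝ → H) (hψ : IsSolution E u T ψ₀ ψ)
    (hsteer : ψ T ∈ Metric.ball ψ₁ ε) :
    ((1 / δ : ℝ) : EReal) *
        ⨆ k : ℕ, extendedQuotient (|‖⟪φ k, ψ₀⟫_ℂ‖ - ‖⟪φ k, ψ₁⟫_ℂ‖| - ε)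
          ‖B ⟨φ k, hAB.mem_domain_B k⟩‖
      ≤ (T : EReal) := by
  have hsup : ⨆ k : ℕ, extendedQuotient (|‖⟪φ k, ψ₀⟫_ℂ‖ - ‖⟪φ k, ψ₁⟫_ℂ‖| - ε)
      ‖B ⟨φ k, hAB.mem_domain_B k⟩‖ ≤ ((δ * T : ℝ) : EReal) := by
    refine iSup_le fun k => extendedQuotient_le_of_lt_mul (norm_nonneg _) ?_
    have hvar := hψ.abs_norm_inner_sub_le hAB huδ hE k
    rw [hψ₀, mul_one, abs_sub_comm] at hvar
    have hend : |‖⟪φ k, ψ T⟫_ℂ‖ - ‖⟪φ k, ψ₁⟫_ℂ‖| < ε := by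
      calc _ ≤ ‖⟪φ k, ψ T⟫_ℂ - ⟪φ k, ψ₁⟫_ℂ‖ := abs_norm_sub_norm_le _ _
        _ = ‖⟪φ k, ψ T - ψ₁⟫_ℂ‖ := by rw [inner_sub_right]
        _ ≤ ‖φ k‖ * ‖ψ T - ψ₁‖ := norm_inner_le_norm _ _
        _ = ‖ψ T - ψ₁‖ := by rw [φ.orthonormal.norm_eq_one k, one_mul]
        _ < ε := mem_ball_iff_norm.1 hsteer
    have htri := abs_sub_le ‖⟪φ k, ψ₀⟫_ℂ‖ ‖⟪φ k, ψ T⟫_ℂ‖ ‖⟪φ k, ψ₁⟫_ℂ‖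
    linarith
  calc _ ≤ ((1 / δ : ℝ) : EReal) * ((δ * T : ℝ) : EReal) :=
        mul_le_mul_of_nonneg_left hsup (EReal.coe_nonneg.2 (by positivity))
    _ = (T : EReal) := by
      rw [← EReal.coe_mul, ← mul_assoc, one_div_mul_cancel hδ.ne', one_mul]
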